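/- Let $X$ be an infinite-dimensional complex Banach space and let $\mathcal B(X)$ be the algebra of bounded linear operators on $X$. An operator $S\in\mathcal B(X)$ is Fredholm if $\dim\ker S<\infty$ and its range $\mathcal R(S)$ is closed and of finite codimension; it is Weyl if moreover $\dim\ker S=\operatorname{codim}\mathcal R(S)$. An operator $R\in\mathcal B(X)$ is Riesz if $R-\mu I$ is Fredholm for every nonzero $\mu\in\mathbb C$. The ascent of $S$ is $a(S)=\inf\{n\ge 0:\ker S^n=\ker S^{n+1}\}$ and the descent is $\delta(S)=\inf\{n\ge 0:\mathcal R(S^n)=\mathcal R(S^{n+1})\}$, with $\inf\emptyset=\infty$. For $S\in\mathcal B(X)$ let - $\sigma(S)$ be the spectrum, $\sigma_a(S)=\{\lambda\in\mathbb C: S-\lambda I \text{ is not bounded below}\}$ the approximate point spectrum, and $\sigma_W(S)=\{\lambda\in\mathbb C: S-\lambda I\text{ is not Weyl}\}$ the Weyl spectrum; - $\Pi^0(S)$ be the set of poles of $S$ of finite rank, that is, of all $\lambda\in\sigma(S)$ such that $a(S-\lambda I)<\infty$, $\delta(S-\lambda I)<\infty$ and $\dim\ker(S-\lambda I)<\infty$;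 - $\Pi_a(S)$ be the set of left poles of $S$, that is, of all $\lambda\in\sigma_a(S)$ such that $a=a(S-\lambda I)<\infty$ and $\mathcal R((S-\lambda I)^{a+1})$ is closed. The operator $S$ has property $(Z_{\Pi_a})$ if $\sigma(S)\setminus\sigma_W(S)=\Pi_a(S)$. **Theorem.** Let $R\in\mathcal B(X)$ be a Riesz operator and let $T\in\mathcal B(X)$ have property $(Z_{\Pi_a})$ and satisfy $TR=RT$. Then the following statements are equivalent: 1. $T+R$ has property $(Z_{\Pi_a})$; 2. $\Pi^0(T+R)=\Pi_a(T+R)$; 3. $\Pi_a(T+R)\cap\sigma(T)\subset\Pi^0(T)$. -/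

import Mathlib

namespace SpectralNotions

variable {X : Type*} [NormedAddCommGroup X] [NormedSpace ℂ X]

/-- The operator `T - λ I`. -/
def shift (T : X →L[ℂ] X) (z : ℂ) : X →L[ℂ] X := T - z • (1 : X →L[ℂ] X)

/-- Weyl operators: Fredholm operators of index zero, the index being
`dim ker T - codim range T`. -/
def IsWeyl (T : X →L[ℂ] X) : Prop :=
  T.IsFredholm ∧
    (Module.finrank ℂ T.ker : ℤ) - (Module.finrank ℂ (X ⧸ T.range) : ℤ) = 0

/-- The Weyl spectrum. -/
def weylSpectrum (T : X →L[ℂ] X) : Set ℂ := {z | ¬ IsWeyl (shift T z)}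

/-- Riesz operators: `R - μ I` is Fredholm for every nonzero complex `μ`. -/
def IsRiesz (R : X →L[ℂ] X) : Prop := ∀ z : ℂ, z ≠ 0 → (shift R z).IsFredholm

/-- The ascent `inf {n ∈ ℕ | ker Tⁿ = ker Tⁿ⁺¹}`, with `inf ∅ = ∞`. -/
noncomputable def ascent (T : X →L[ℂ] X) : ℕ∞ :=
  sInf {m : ℕ∞ | ∃ n : ℕ, m = n ∧ (T ^ n).ker = (T ^ (n + 1)).ker}

/-- The descent `inf {n ∈ ℕ | range Tⁿ = range Tⁿ⁺¹}`, with `inf ∅ = ∞`. -/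
noncomputable def descent (T : X →L[ℂ] X) : ℕ∞ :=
  sInf {m : ℕ∞ | ∃ n : ℕ, m = n ∧ (T ^ n).range = (T ^ (n + 1)).range}

/-- The approximate point spectrum: those `λ` for which `T - λ I` is not bounded below. -/
def approxPointSpectrum (T : X →L[ℂ] X) : Set ℂ :=
  {z | ¬ ∃ c : ℝ, 0 < c ∧ ∀ x : X, c * ‖x‖ ≤ ‖shift T z x‖}

/-- The poles of the resolvent of `T`. -/
def poles (T : X →L[ℂ] X) : Set ℂ :=
  {z | z ∈ spectrum ℂ T ∧ ascent (shift T z) < ⊤ ∧ descent (shift T z) < ⊤}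

/-- The poles of the resolvent of finite rank: poles `λ` with `ker (T - λ I)` finite-dimensional. -/
def finiteRankPoles (T : X →L[ℂ] X) : Set ℂ :=
  {z | z ∈ poles T ∧ FiniteDimensional ℂ (shift T z).ker}

/-- The left poles: points `λ` of the approximate point spectrum such that `T - λ I` has finite
ascent `a` and `(T - λ I)ᵃ⁺¹` has closed range. -/
def leftPoles (T : X →L[ℂ] X) : Set ℂ :=
  {z | z ∈ approxPointSpectrum T ∧
    ∃ a : ℕ, ascent (shift T z) = a ∧ IsClosed ((shift T z ^ (a + 1)).range : Set X)}

/-- Property `(Z_{Π_a})`. -/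
def PropertyZ (T : X →L[ℂ] X) : Prop := spectrum ℂ T \ weylSpectrum T = leftPoles T

end SpectralNotions

/-! For every `z`, the operators `T - z` and `T + R - z` differ by a Riesz operator commuting with
both, so everything rests on two stability facts: commuting Riesz perturbations preserve Weyl
operators (`IsUnitAddFiniteRank.add_riesz`) and Browder operators (`IsBrowder.add_riesz`). Finite
rank poles are the spectral points where the shift is Browder; they are always left poles and always
lie outside the Weyl spectrum. A Weyl operator of finite ascent is Browder, so `PropertyZ` forces
left poles to be finite rank poles. The remaining implications compare `T + R` with `T` at `z`:
either `T - z` is invertible, hence Browder, or `z` lies in the spectrum of `T` and the hypotheses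
apply.

For stability, write a Weyl operator as `U + F` with `U` invertible and `F` of finite rank, so that
`U + F + R = U (1 + U⁻¹ R) + F`. Modulo the closure of the finite rank operators, `R` has spectrum
in `{0}` and commutes with `U⁻¹`, so some power of `U⁻¹ R` is close to finite rank, and the
Riesz–Schauder argument (`isBrowder_one_sub`) makes `1 + U⁻¹ R` Browder. In the Browder case `U` can
be chosen to commute with `R` and with `F`, which also controls kernels of powers. -/

open Filter Topology

/-! ### Quotients of normed algebras by closed ideals -/

section QuotientByIdeal

variable {A : Type*} [NormedRing A] [NormedAlgebra ℂ A]

/-- The quotient of a normed ring by a closed two-sided ideal is a normed ring. -/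
@[reducible] noncomputable def Ideal.quotientNormedRing (I : Ideal A) [I.IsTwoSided]
    [IsClosed (I : Set A)] : NormedRing (A ⧸ I) :=
  { Ideal.Quotient.ring I, Submodule.Quotient.normedAddCommGroup I with
    norm_mul_le := fun x y => le_of_forall_pos_le_add fun ε hε => by
      have key : Tendsto (fun δ : ℝ => (‖x‖ + δ) * (‖y‖ + δ)) (𝓝[>] 0) (𝓝 (‖x‖ * ‖y‖)) := by
        have : Continuous fun δ : ℝ => (‖x‖ + δ) * (‖y‖ + δ) := by fun_prop
        simpa using (this.tendsto 0).mono_left nhdsWithin_le_nhds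
      obtain ⟨δ, hδ, hδ0⟩ := ((key.eventually (gt_mem_nhds (lt_add_of_pos_right _ hε))).and
        self_mem_nhdsWithin).exists
      obtain ⟨a, rfl, ha⟩ := Submodule.Quotient.norm_mk_lt x hδ0
      obtain ⟨b, rfl, hb⟩ := Submodule.Quotient.norm_mk_lt y hδ0
      calc ‖(Submodule.Quotient.mk (a * b) : A ⧸ I)‖ ≤ ‖a * b‖ := Submodule.Quotient.norm_mk_le I _
        _ ≤ ‖a‖ * ‖b‖ := norm_mul_le a b
        _ ≤ _ := (mul_le_mul ha.le hb.le (norm_nonneg _) ((norm_nonneg _).trans ha.le)).trans hδ.le }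

/-- The quotient of a normed algebra by a closed two-sided ideal is a normed algebra. -/
@[reducible] noncomputable def Ideal.quotientNormedAlgebra (I : Ideal A) [I.IsTwoSided]
    [IsClosed (I : Set A)] :
    letI := I.quotientNormedRing
    NormedAlgebra ℂ (A ⧸ I) :=
  letI := I.quotientNormedRing
  { (Ideal.Quotient.algebra ℂ : Algebra ℂ (A ⧸ I)) with
    norm_smul_le := fun z x => by
      obtain ⟨a, rfl⟩ := Ideal.Quotient.mk_surjective x
      refine le_of_forall_pos_le_add fun ε hε => ?_
      have hz : 0 < ‖z‖ + 1 := by positivity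
      obtain ⟨b, hb, hbε⟩ := Submodule.Quotient.norm_mk_lt (S := I) (Ideal.Quotient.mk I a)
        (div_pos hε hz)
      have hab : z • (Ideal.Quotient.mk I a) = Ideal.Quotient.mk I (z • b) := by
        have : Ideal.Quotient.mk I a = Ideal.Quotient.mk I b := hb.symm
        rw [this]
        rfl
      calc ‖z • (Ideal.Quotient.mk I a)‖ = ‖Ideal.Quotient.mk I (z • b)‖ := by rw [hab]
        _ ≤ ‖z • b‖ := Submodule.Quotient.norm_mk_le I _
        _ ≤ ‖z‖ * (‖(Ideal.Quotient.mk I a)‖ + ε / (‖z‖ + 1)) := by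
          rw [norm_smul]
          exact mul_le_mul_of_nonneg_left hbε.le (norm_nonneg z)
        _ ≤ ‖z‖ * ‖(Ideal.Quotient.mk I a)‖ + ε := by
          rw [mul_add, ← mul_div_assoc, mul_comm ‖z‖ ε, mul_div_assoc]
          gcongr
          exact mul_le_of_le_one_right hε.le ((div_le_one hz).2 (by linarith)) }

omit [NormedAlgebra ℂ A] in
theorem Ideal.isTwoSided_closure (I : Ideal A) [I.IsTwoSided] : I.closure.IsTwoSided :=
  ⟨fun {a} b ha => by
    have h : Set.MapsTo (fun x => x * b) (I : Set A) I := fun x hx => I.mul_mem_right b hx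
    exact h.closure (by fun_prop) ha⟩

end QuotientByIdeal

/-! ### Quasinilpotence modulo an ideal -/

/-- An element of a complex Banach algebra whose spectrum is contained in `{0}` is
topologically nilpotent. -/
theorem eventually_norm_pow_le_of_spectrum_subset {A : Type*} [NormedRing A] [NormedAlgebra ℂ A]
    [CompleteSpace A] {a : A} (ha : spectrum ℂ a ⊆ {0}) {δ : ℝ} (hδ : 0 < δ) :
    ∀ᶠ n : ℕ in atTop, ‖a ^ n‖ ≤ δ ^ n := by
  have h0 : spectralRadius ℂ a = 0 := by
    simp only [spectralRadius, ENNReal.iSup_eq_zero]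
    intro z hz
    simp [Set.mem_singleton_iff.1 (ha hz)]
  have h := spectrum.pow_norm_pow_one_div_tendsto_nhds_spectralRadius a
  rw [h0] at h
  filter_upwards [h.eventually (gt_mem_nhds (ENNReal.ofReal_pos.2 hδ)), eventually_gt_atTop 0]
    with n hn hn0
  rw [ENNReal.ofReal_lt_ofReal_iff hδ] at hn
  calc ‖a ^ n‖ = (‖a ^ n‖ ^ (1 / n : ℝ)) ^ n := by
        rw [one_div, Real.rpow_inv_natCast_pow (norm_nonneg _) hn0.ne']
    _ ≤ δ ^ n := by gcongr

/-- If `a - z` is invertible modulo a two-sided ideal `I` for all `z ≠ 0`, and `v` commutes with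
`a` modulo `I`, then some power of `v * a` is arbitrarily close to `I`. -/
theorem exists_norm_mul_pow_sub_lt {A : Type*} [NormedRing A] [NormedAlgebra ℂ A]
    [CompleteSpace A] (I : Ideal A) [I.IsTwoSided] {a v : A}
    (ha : ∀ z : ℂ, z ≠ 0 → ∃ b, b * (a - z • 1) - 1 ∈ I ∧ (a - z • 1) * b - 1 ∈ I)
    (hv : v * a - a * v ∈ I) {ε : ℝ} (hε : 0 < ε) :
    ∃ n : ℕ, 0 < n ∧ ∃ c ∈ I, ‖(v * a) ^ n - c‖ < ε := by
  have := I.isTwoSided_closure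
  have : IsClosed (I.closure : Set A) := isClosed_closure
  let _ := Ideal.quotientNormedRing I.closure
  let _ := Ideal.quotientNormedAlgebra I.closure
  have : CompleteSpace (A ⧸ I.closure) := Submodule.Quotient.completeSpace _
  let q : A →+* A ⧸ I.closure := Ideal.Quotient.mk I.closure
  have hq : ∀ {x y : A}, x - y ∈ I → q x = q y := fun {x y} h =>
    Ideal.Quotient.eq.2 (subset_closure h)
  have hsp : spectrum ℂ (q a) ⊆ {0} := by
    intro z hz
    by_contra hz0
    obtain ⟨b, hb1, hb2⟩ := ha z hz0
    have h1 := hq hb1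
    have h2 := hq hb2
    rw [map_mul, map_one] at h1 h2
    have hu : IsUnit (q (a - z • 1)) := ⟨⟨_, _, h2, h1⟩, rfl⟩
    refine hz (spectrum.mem_resolventSet_iff.2 ?_)
    rw [← IsUnit.neg_iff]
    convert hu using 1
    rw [map_sub, neg_sub]
    rw [Algebra.smul_def, mul_one]
    rfl
  have hcomm : Commute (q v) (q a) := by
    have := hq hv
    rwa [map_mul, map_mul] at this
  -- This `δ` makes `‖q v‖ * δ ≤ 1 / 2`, so powers of the product decay geometrically; the `+ 1`
  -- covers `q v = 0`.
  have hδ : 0 < (2 * (‖q v‖ + 1))⁻¹ := by positivity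
  have hlim : ∀ᶠ n : ℕ in atTop, (1 / 2 : ℝ) ^ n < ε :=
    (tendsto_pow_atTop_nhds_zero_of_lt_one (by norm_num) (by norm_num)).eventually
      (gt_mem_nhds hε)
  obtain ⟨n, hn1, hn2, hn0⟩ := ((eventually_norm_pow_le_of_spectrum_subset hsp hδ).and
    (hlim.and (eventually_gt_atTop 0))).exists
  have hnorm : ‖q ((v * a) ^ n)‖ < ε := by
    rw [map_pow, map_mul, hcomm.mul_pow]
    calc ‖q v ^ n * q a ^ n‖ ≤ ‖q v‖ ^ n * (2 * (‖q v‖ + 1))⁻¹ ^ n :=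
          (norm_mul_le _ _).trans (mul_le_mul (norm_pow_le' _ hn0) hn1 (norm_nonneg _)
            (by positivity))
      _ = (‖q v‖ * (2 * (‖q v‖ + 1))⁻¹) ^ n := (mul_pow _ _ _).symm
      _ ≤ (1 / 2) ^ n := by
          gcongr
          rw [← div_eq_mul_inv, div_le_div_iff₀ (by positivity) (by norm_num)]
          linarith [norm_nonneg (q v)]
      _ < ε := hn2
  -- A small representative `m` of the class differs from the power by an element of the closure of
  -- `I`; the slack `ε - ‖m‖` pays for moving that element into `I` itself.
  obtain ⟨m, hm, hmε⟩ := Submodule.Quotient.norm_mk_lt (S := I.closure) (q ((v * a) ^ n))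
    (sub_pos.2 hnorm)
  have hm' : ‖m‖ < ε := by linarith
  have hmem : (v * a) ^ n - m ∈ closure (I : Set A) := Ideal.Quotient.eq.1 hm.symm
  obtain ⟨c, hc, hcd⟩ := Metric.mem_closure_iff.1 hmem _ (sub_pos.2 hm')
  refine ⟨n, hn0, c, hc, ?_⟩
  rw [dist_eq_norm] at hcd
  calc ‖(v * a) ^ n - c‖ = ‖((v * a) ^ n - m - c) + m‖ := by congr 1; abel
    _ ≤ ‖(v * a) ^ n - m - c‖ + ‖m‖ := norm_add_le _ _
    _ < ε := by linarith

/-! ### Index of the identity plus finite rank -/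

section IndexOfOneAddFiniteRank

variable {K V : Type*} [Field K] [AddCommGroup V] [Module K V]

/-- The identity plus a finite rank map has index zero. -/
theorem LinearMap.HasFiniteRange.finrank_ker_one_add_eq {G : V →ₗ[K] V} (hG : G.HasFiniteRange) :
    Module.finrank K (LinearMap.ker (1 + G)) =
      Module.finrank K (V ⧸ LinearMap.range (1 + G)) := by
  -- Since `1 + G` is the identity modulo `M`, its kernel and cokernel are those of its restriction
  -- to the finite-dimensional `M`, where rank–nullity applies.
  set M := LinearMap.range G with hM
  have : FiniteDimensional K M := .of_fg hG
  have hmem : ∀ x, (1 + G) x ∈ M → x ∈ M := fun x hx => by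
    have : x = (1 + G) x - G x := by simp
    rw [this]
    exact M.sub_mem hx ⟨x, rfl⟩
  have hmaps : ∀ x ∈ M, (1 + G) x ∈ M := fun x hx => M.add_mem hx ⟨x, rfl⟩
  let e : M →ₗ[K] M := (1 + G).restrict hmaps
  have hker : LinearMap.ker (1 + G) = (LinearMap.ker e).map M.subtype := by
    ext x
    simp only [LinearMap.mem_ker, Submodule.mem_map, Submodule.coe_subtype, Subtype.exists,
      exists_and_right, exists_eq_right]
    constructor
    · intro hx
      exact ⟨hmem x (hx ▸ M.zero_mem), Subtype.ext hx⟩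
    · rintro ⟨h, hx⟩
      exact congrArg Subtype.val hx
  let q : M →ₗ[K] V ⧸ LinearMap.range (1 + G) := (LinearMap.range (1 + G)).mkQ ∘ₗ M.subtype
  have hq : Function.Surjective q := by
    intro y
    obtain ⟨x, rfl⟩ := Submodule.mkQ_surjective _ y
    refine ⟨⟨G (-x), ⟨_, rfl⟩⟩, (Submodule.Quotient.eq _).2 ⟨-x, ?_⟩⟩
    simp [sub_eq_add_neg, add_comm]
  have hkq : LinearMap.ker q = LinearMap.range e := by
    ext ⟨x, hx⟩
    simp only [q, LinearMap.ker_comp, Submodule.ker_mkQ, Submodule.mem_comap,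
      Submodule.coe_subtype, LinearMap.mem_range]
    constructor
    · rintro ⟨y, rfl⟩
      exact ⟨⟨y, hmem y hx⟩, rfl⟩
    · rintro ⟨y, hy⟩
      exact ⟨y, congrArg Subtype.val hy⟩
  rw [hker, Submodule.finrank_map_subtype_eq, ← (q.quotKerEquivOfSurjective hq).finrank_eq, hkq]
  have h1 := LinearMap.finrank_range_add_finrank_ker e
  have h2 := Submodule.finrank_quotient_add_finrank (LinearMap.range e)
  omega

end IndexOfOneAddFiniteRank

/-! ### Fredholm and Weyl operators modulo finite rank -/

namespace SpectralNotions

variable {X : Type*} [NormedAddCommGroup X] [NormedSpace ℂ X]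

variable (X) in
/-- The two-sided ideal of bounded operators of finite rank. -/
def finiteRankIdeal : Ideal (X →L[ℂ] X) where
  carrier := {F | F.toLinearMap.HasFiniteRange}
  zero_mem' := LinearMap.HasFiniteRange.zero
  add_mem' hF hG := LinearMap.HasFiniteRange.add hF hG
  smul_mem' S _ hF := LinearMap.HasFiniteRange.comp_left hF S.toLinearMap

theorem mem_finiteRankIdeal {F : X →L[ℂ] X} :
    F ∈ finiteRankIdeal X ↔ F.toLinearMap.HasFiniteRange := Iff.rfl

instance : (finiteRankIdeal X).IsTwoSided :=
  ⟨fun S hF => LinearMap.HasFiniteRange.comp_right hF S.toLinearMap⟩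

/-- Atkinson's theorem for finite rank operators. -/
theorem isFredholm_iff_exists_inverse_mod_finiteRank {S : X →L[ℂ] X} :
    S.IsFredholm ↔
      ∃ B, B * S - 1 ∈ finiteRankIdeal X ∧ S * B - 1 ∈ finiteRankIdeal X := by
  rw [ContinuousLinearMap.isFredholm_iff_exists_isQuasiInverse]
  refine exists_congr fun B => and_congr ?_ ?_
  · exact LinearMap.FiniteRangeSetoid.equiv_iff_hasFiniteRange
  · exact LinearMap.FiniteRangeSetoid.equiv_iff_hasFiniteRange

/-- A factor of a Fredholm product of commuting operators is Fredholm. -/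
theorem isFredholm_of_commute_mul {S Q : X →L[ℂ] X} (h : Commute S Q)
    (hSQ : (S * Q).IsFredholm) : S.IsFredholm := by
  obtain ⟨B, hB1, hB2⟩ := isFredholm_iff_exists_inverse_mod_finiteRank.1 hSQ
  -- Modulo finite rank, `Q * B` is a right inverse of `S` and, by commutation, `B * Q` a left
  -- inverse; the two therefore agree in the quotient.
  refine isFredholm_iff_exists_inverse_mod_finiteRank.2 ⟨Q * B, ?_, ?_⟩
  · have h1 : B * Q * S - 1 ∈ finiteRankIdeal X := by
      rwa [mul_assoc, ← h.eq]
    have h2 : S * (Q * B) - 1 ∈ finiteRankIdeal X := by rwa [← mul_assoc]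
    have : Q * B * S - 1 = (B * Q * S - 1) + (Q * B - B * Q) * S := by noncomm_ring
    rw [this]
    refine add_mem h1 (Ideal.mul_mem_right _ _ ?_)
    have : Q * B - B * Q = B * Q * (S * (Q * B) - 1) - (B * Q * S - 1) * (Q * B) := by
      noncomm_ring
    rw [this]
    exact sub_mem (Ideal.mul_mem_left _ _ h2) (Ideal.mul_mem_right _ _ h1)
  · rwa [← mul_assoc]

/-- The sum of an invertible operator and a finite rank operator. -/
def IsUnitAddFiniteRank (S : X →L[ℂ] X) : Prop :=
  ∃ U : (X →L[ℂ] X)ˣ, S - U ∈ finiteRankIdeal X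

namespace IsUnitAddFiniteRank

variable {S T F : X →L[ℂ] X}

theorem of_isUnit (h : IsUnit S) : IsUnitAddFiniteRank S :=
  ⟨h.unit, by simp⟩

theorem add_finiteRank (h : IsUnitAddFiniteRank S) (hF : F ∈ finiteRankIdeal X) :
    IsUnitAddFiniteRank (S + F) := by
  obtain ⟨U, hU⟩ := h
  refine ⟨U, ?_⟩
  rw [add_sub_right_comm]
  exact (finiteRankIdeal X).add_mem hU hF

theorem mul (hS : IsUnitAddFiniteRank S) (hT : IsUnitAddFiniteRank T) :
    IsUnitAddFiniteRank (S * T) := by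
  obtain ⟨U, hU⟩ := hS
  obtain ⟨V, hV⟩ := hT
  refine ⟨U * V, ?_⟩
  have : S * T - ↑(U * V) = S * (T - V) + (S - U) * V := by
    push_cast; noncomm_ring
  rw [this]
  exact (finiteRankIdeal X).add_mem (Ideal.mul_mem_left _ _ hV) (Ideal.mul_mem_right _ _ hU)

theorem pow (hS : IsUnitAddFiniteRank S) (n : ℕ) : IsUnitAddFiniteRank (S ^ n) := by
  induction n with
  | zero => exact of_isUnit (by simp)
  | succ n ih => rw [pow_succ]; exact ih.mul hS

theorem isFredholm (hS : IsUnitAddFiniteRank S) : S.IsFredholm := by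
  obtain ⟨U, hU⟩ := hS
  refine isFredholm_iff_exists_inverse_mod_finiteRank.2 ⟨↑U⁻¹, ?_, ?_⟩
  · rw [← U.inv_mul, ← mul_sub]
    exact Ideal.mul_mem_left _ _ hU
  · rw [← U.mul_inv, ← sub_mul]
    exact Ideal.mul_mem_right _ _ hU

/-- Factoring `S = U (1 + G)` with `G = U⁻¹ (S - U)` of finite rank reduces this to `1 + G`, as `U`
changes neither kernel nor codimension of the range. -/
theorem finrank_ker_eq (hS : IsUnitAddFiniteRank S) :
    Module.finrank ℂ S.ker = Module.finrank ℂ (X ⧸ S.range) := by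
  obtain ⟨U, hU⟩ := hS
  have hG : ((↑U⁻¹ * (S - U) : X →L[ℂ] X)).toLinearMap.HasFiniteRange :=
    Ideal.mul_mem_left _ _ hU
  have key := hG.finrank_ker_one_add_eq
  set e : X →ₗ[ℂ] X := 1 + ((↑U⁻¹ * (S - U) : X →L[ℂ] X)).toLinearMap with he
  let u : X ≃ₗ[ℂ] X := (ContinuousLinearEquiv.ofUnit U).toLinearEquiv
  have hSe : S.toLinearMap = u.toLinearMap ∘ₗ e := by
    ext x
    have h1 : S = U * (1 + ↑U⁻¹ * (S - U)) := by simp [mul_add]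
    exact congrArg (fun A : X →L[ℂ] X => A x) h1
  have hker : LinearMap.ker S.toLinearMap = LinearMap.ker e := by
    rw [hSe]; exact LinearEquiv.ker_comp u e
  have hran : (LinearMap.range e).map u.toLinearMap = LinearMap.range S.toLinearMap := by
    rw [hSe, LinearMap.range_comp]
  rw [(Submodule.Quotient.equiv _ _ u hran).finrank_eq] at key
  rw [← key, ← hker]

theorem isWeyl (hS : IsUnitAddFiniteRank S) : IsWeyl S :=
  ⟨hS.isFredholm, by rw [hS.finrank_ker_eq, sub_self]⟩

end IsUnitAddFiniteRank

/-- Index zero gives the kernel and a complement `N` of the range the same finite dimension.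
Projecting onto the kernel and mapping it isomorphically onto `N` yields a finite rank `G` with `S +
G` bijective. This form of the Weyl condition is the one that perturbs algebraically. -/
theorem isWeyl_iff_isUnitAddFiniteRank [CompleteSpace X] {S : X →L[ℂ] X} :
    IsWeyl S ↔ IsUnitAddFiniteRank S := by
  refine ⟨fun ⟨hF, hind⟩ => ?_, IsUnitAddFiniteRank.isWeyl⟩
  have := hF.finite_ker
  have : FiniteDimensional ℂ (X ⧸ S.range) := hF.finite_coker
  obtain ⟨p, hp⟩ := hF.closedComplemented_ker
  obtain ⟨N, hN⟩ := S.range.exists_isCompl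
  have e := Submodule.quotientEquivOfIsCompl _ _ hN
  have : FiniteDimensional ℂ N := e.finiteDimensional
  let j : S.ker ≃ₗ[ℂ] N := LinearEquiv.ofFinrankEq _ _ (by
    rw [← e.finrank_eq]; omega)
  let G : X →L[ℂ] X := (LinearMap.toContinuousLinearMap (N.subtype ∘ₗ j.toLinearMap)) ∘L p
  have hGx : ∀ x, G x = j (p x) := fun x => rfl
  have hG : G ∈ finiteRankIdeal X := by
    refine LinearMap.HasFiniteRange.comp_right ?_ p.toLinearMap
    exact LinearMap.HasFiniteRange.of_finite_dom
  have hu : IsUnit (S + G) := by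
    rw [ContinuousLinearMap.isUnit_iff_bijective]
    constructor
    · rw [injective_iff_map_eq_zero]
      intro x hx
      have h1 : S x = - G x := eq_neg_of_add_eq_zero_left hx
      have h2 : S x ∈ N := by rw [h1, hGx]; exact N.neg_mem (j (p x)).2
      have h3 : S x = 0 := Submodule.disjoint_def.1 hN.disjoint _ ⟨x, rfl⟩ h2
      have h4 : j (p x) = 0 := by
        rw [h3, hGx, zero_eq_neg] at h1
        exact Subtype.ext h1
      have h5 := hp ⟨x, h3⟩
      rw [j.map_eq_zero_iff] at h4
      rw [h4] at h5
      exact (congrArg Subtype.val h5).symm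
    · intro y
      obtain ⟨_, ⟨x, rfl⟩, n, hn, rfl⟩ :=
        Submodule.mem_sup.1 (hN.sup_eq_top.symm ▸ Submodule.mem_top : y ∈ _ ⊔ N)
      -- Changing `x` within the kernel leaves `S x` fixed, so its kernel component can be replaced
      -- by the one that `G` sends to `n`.
      refine ⟨x - p x + (j.symm ⟨n, hn⟩ : S.ker), ?_⟩
      have h1 : ∀ k : S.ker, S k = 0 := fun k => k.2
      have h2 : p (x - p x + (j.symm ⟨n, hn⟩ : S.ker)) = j.symm ⟨n, hn⟩ := by
        rw [map_add, map_sub, hp, hp]; simp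
      rw [add_apply, hGx, h2]
      simp [h1]
  have := (IsUnitAddFiniteRank.of_isUnit hu).add_finiteRank (neg_mem hG)
  rwa [add_neg_cancel_right] at this

end SpectralNotions

/-! ### Kernel and range chains, Fitting decomposition -/

section PowerChains

variable {K V : Type*} [Field K] [AddCommGroup V] [Module K V]

theorem Module.End.range_pow_constant {f : Module.End K V} {k : ℕ}
    (h : LinearMap.range (f ^ k) = LinearMap.range (f ^ (k + 1))) (m : ℕ) :
    LinearMap.range (f ^ (k + m)) = LinearMap.range (f ^ k) := by
  induction m with
  | zero => rfl
  | succ m ih =>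
    rw [← add_assoc, pow_succ', Module.End.mul_eq_comp, LinearMap.range_comp, ih,
      ← LinearMap.range_comp, ← Module.End.mul_eq_comp, ← pow_succ', h]

theorem Module.End.finiteDimensional_ker_pow {f : Module.End K V}
    (hf : FiniteDimensional K (LinearMap.ker f)) (n : ℕ) :
    FiniteDimensional K (LinearMap.ker (f ^ n)) := by
  induction n with
  | zero =>
    rw [pow_zero, Module.End.one_eq_id, LinearMap.ker_id]
    infer_instance
  | succ n ih =>
    rw [pow_succ', Module.End.mul_eq_comp]
    refine .of_fg (Submodule.fg_of_fg_map_of_fg_inf_ker (f ^ n) ?_ ?_)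
    · rw [LinearMap.ker_comp]
      have : FiniteDimensional K ((LinearMap.ker f).comap (f ^ n) |>.map (f ^ n)) :=
        Submodule.finiteDimensional_of_le (Submodule.map_comap_le _ _)
      exact Module.Finite.iff_fg.1 this
    · have : FiniteDimensional K
          (LinearMap.ker (f ∘ₗ f ^ n) ⊓ LinearMap.ker (f ^ n) : Submodule K V) :=
        Submodule.finiteDimensional_of_le inf_le_right
      exact Module.Finite.iff_fg.1 this

/-- Fitting decomposition of an endomorphism with stable kernel and range. -/
theorem Module.End.isCompl_range_pow_ker_pow {f : Module.End K V} {n : ℕ}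
    (hker : LinearMap.ker (f ^ n) = LinearMap.ker (f ^ (n + n)))
    (hran : LinearMap.range (f ^ (n + n)) = LinearMap.range (f ^ n)) :
    IsCompl (LinearMap.range (f ^ n)) (LinearMap.ker (f ^ n)) := by
  constructor
  · rw [Submodule.disjoint_def]
    rintro _ ⟨y, rfl⟩ hy
    have : y ∈ LinearMap.ker (f ^ (n + n)) := by
      rw [pow_add]
      exact hy
    rwa [← hker] at this
  · rw [codisjoint_iff, eq_top_iff]
    intro x _
    obtain ⟨y, hy⟩ : (f ^ n) x ∈ LinearMap.range (f ^ (n + n)) := hran ▸ ⟨x, rfl⟩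
    refine Submodule.mem_sup.2 ⟨(f ^ n) y, ⟨y, rfl⟩, x - (f ^ n) y, ?_, by abel⟩
    rw [LinearMap.mem_ker, map_sub, ← hy, pow_add]
    exact sub_self _

end PowerChains

/-! ### Browder operators -/

namespace SpectralNotions

variable {X : Type*} [NormedAddCommGroup X] [NormedSpace ℂ X]

/-- Operators with finite ascent, finite descent and finite-dimensional kernel. -/
structure IsBrowder (S : X →L[ℂ] X) : Prop where
  exists_ker_eq : ∃ n : ℕ, (S ^ n).ker = (S ^ (n + 1)).ker
  exists_range_eq : ∃ n : ℕ, (S ^ n).range = (S ^ (n + 1)).range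
  finiteDimensional_ker : FiniteDimensional ℂ S.ker

theorem toLinearMap_pow (S : X →L[ℂ] X) (n : ℕ) :
    (S ^ n).toLinearMap = (S.toLinearMap : Module.End ℂ X) ^ n := by
  ext x
  simp

theorem ker_pow_eq_of_le {S : X →L[ℂ] X} {n : ℕ} (h : (S ^ n).ker = (S ^ (n + 1)).ker)
    {m : ℕ} (hm : n ≤ m) : (S ^ m).ker = (S ^ n).ker := by
  obtain ⟨k, rfl⟩ := Nat.exists_eq_add_of_le hm
  simp only [toLinearMap_pow] at h ⊢
  exact (Module.End.ker_pow_constant h k).symm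

theorem range_pow_eq_of_le {S : X →L[ℂ] X} {n : ℕ} (h : (S ^ n).range = (S ^ (n + 1)).range)
    {m : ℕ} (hm : n ≤ m) : (S ^ m).range = (S ^ n).range := by
  obtain ⟨k, rfl⟩ := Nat.exists_eq_add_of_le hm
  simp only [toLinearMap_pow] at h ⊢
  exact Module.End.range_pow_constant h k

theorem isBrowder_of_isUnit {S : X →L[ℂ] X} (h : IsUnit S) : IsBrowder S := by
  obtain ⟨U, rfl⟩ := h
  let e := (ContinuousLinearEquiv.ofUnit U).toLinearEquiv
  have hk : (U : X →L[ℂ] X).ker = ⊥ := LinearEquiv.ker e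
  have hr : (U : X →L[ℂ] X).range = ⊤ := LinearEquiv.range e
  refine ⟨⟨0, ?_⟩, ⟨0, ?_⟩, ?_⟩
  · rw [zero_add, pow_one, hk, pow_zero]
    exact LinearMap.ker_id
  · rw [zero_add, pow_one, hr, pow_zero]
    exact LinearMap.range_id
  · rw [hk]
    infer_instance

/-- The range of an operator is closed if it has a finite-dimensional kernel which is also an
algebraic complement of the range. -/
theorem isClosed_range_of_isCompl_ker [CompleteSpace X] {S : X →L[ℂ] X}
    [FiniteDimensional ℂ S.ker] (h : IsCompl S.range S.ker) : IsClosed (S.range : Set X) := by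
  -- Restricting `S` to a closed complement of its kernel keeps the range and gives injectivity, so
  -- a closed algebraic complement of the range suffices.
  obtain ⟨C, hC, hcompl⟩ :=
    (Submodule.ClosedComplemented.of_finiteDimensional S.ker).exists_isClosed_isCompl
  have : CompleteSpace C := hC.completeSpace_coe
  have hran : (S ∘L C.subtypeL).range = S.range := by
    refine le_antisymm ?_ ?_
    · rintro _ ⟨x, rfl⟩
      exact ⟨x, rfl⟩
    · rintro _ ⟨x, rfl⟩
      obtain ⟨k, hk, c, hc, rfl⟩ :=
        Submodule.mem_sup.1 (hcompl.sup_eq_top.symm ▸ Submodule.mem_top : x ∈ S.ker ⊔ C)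
      refine ⟨⟨c, hc⟩, ?_⟩
      have hk' : S k = 0 := hk
      simp [hk']
  have hker : (S ∘L C.subtypeL).ker = ⊥ := by
    rw [LinearMap.ker_eq_bot']
    intro c hc
    exact Subtype.ext (Submodule.disjoint_def.1 hcompl.disjoint _ hc c.2)
  rw [← hran]
  refine ContinuousLinearMap.closed_complemented_range_of_isCompl_of_ker_eq_bot _ S.ker ?_
    S.isClosed_ker hker
  rwa [hran]

/-- A Browder operator becomes invertible after adding a finite rank projection that commutes
with its whole commutant. -/
theorem IsBrowder.exists_finiteRank_isUnit_add [CompleteSpace X] {S : X →L[ℂ] X}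
    (hS : IsBrowder S) :
    ∃ P ∈ finiteRankIdeal X, (∀ R, Commute S R → Commute P R) ∧ IsUnit (S + P) := by
  obtain ⟨⟨n, hn⟩, ⟨m, hm⟩, hfd⟩ := hS
  -- Both chains are stable from `max n m` on; the `+ 1` ensures that `ker S` lies in `ker (S ^ p)`.
  set p := max n m + 1 with hp
  have hnp : n ≤ p := by omega
  have hmp : m ≤ p := by omega
  have hker : (S ^ p).ker = (S ^ (p + p)).ker := by
    rw [ker_pow_eq_of_le hn hnp, ker_pow_eq_of_le hn (m := p + p) (by omega)]
  have hran : (S ^ (p + p)).range = (S ^ p).range := by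
    rw [range_pow_eq_of_le hm hmp, range_pow_eq_of_le hm (by omega)]
  have hran1 : (S ^ (p + 1)).range = (S ^ p).range := by
    rw [range_pow_eq_of_le hm hmp, range_pow_eq_of_le hm (by omega)]
  have hker1 : (S ^ (p + 1)).ker = (S ^ p).ker := by
    rw [ker_pow_eq_of_le hn hnp, ker_pow_eq_of_le hn (by omega)]
  have hcompl : IsCompl (S ^ p).range (S ^ p).ker := by
    simp only [toLinearMap_pow] at hker hran ⊢
    exact Module.End.isCompl_range_pow_ker_pow hker hran
  have : FiniteDimensional ℂ (S ^ p).ker := by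
    rw [toLinearMap_pow]
    exact Module.End.finiteDimensional_ker_pow hfd p
  have htop := (Submodule.IsCompl.isTopCompl_of_isClosed_of_finiteDimensional hcompl
    (isClosed_range_of_isCompl_ker hcompl)).symm
  set P := (S ^ p).ker.projectionL (S ^ p).range htop with hP
  have hPN : ∀ x ∈ (S ^ p).ker, P x = x := fun x hx =>
    (Submodule.projectionL_eq_self_iff htop x).2 hx
  have hPM : ∀ x ∈ (S ^ p).range, P x = 0 := fun x hx =>
    (Submodule.projectionL_apply_eq_zero_iff htop).2 hx
  have hdec : ∀ x, ∃ y ∈ (S ^ p).range, ∃ z ∈ (S ^ p).ker, y + z = x := fun x =>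
    Submodule.mem_sup.1 (hcompl.sup_eq_top.symm ▸ Submodule.mem_top)
  have hcomm : ∀ R, Commute S R → Commute P R := by
    intro R hR
    have hRp : ∀ x, (S ^ p) (R x) = R ((S ^ p) x) := fun x =>
      congrArg (fun A : X →L[ℂ] X => A x) (hR.pow_left p).eq
    ext x
    obtain ⟨_, ⟨y, rfl⟩, z, hz, rfl⟩ := hdec x
    have h1 : P (R ((S ^ p) y)) = 0 := hPM _ ⟨R y, hRp y⟩
    have h2 : P (R z) = R z := hPN _ (by
      change (S ^ p) (R z) = 0
      have : (S ^ p) z = 0 := hz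
      rw [hRp, this, map_zero])
    have h3 : P ((S ^ p) y) = 0 := hPM _ ⟨y, rfl⟩
    have h4 : P z = z := hPN _ hz
    change P (R ((S ^ p) y + z)) = R (P ((S ^ p) y + z))
    simp only [map_add, h1, h2, h3, h4, map_zero]
  refine ⟨P, ?_, hcomm, ?_⟩
  · rw [mem_finiteRankIdeal, LinearMap.hasFiniteRange_iff_range]
    have : P.toLinearMap.range = (S ^ p).ker := Submodule.range_projection htop.isCompl
    rw [this]
    exact Module.Finite.iff_fg.1 ‹_›
  · have hSPcomm : ∀ x, P (S x) = S (P x) := fun x =>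
      congrArg (fun A : X →L[ℂ] X => A x) (hcomm S (Commute.refl S)).eq
    -- Applying `P` gives `S (P x) = -P x`, which contradicts nilpotence of `S` on `ker (S ^ p)`
    -- unless `P x = 0`; then `S x = 0`, so `x` is in that kernel and equals `P x`.
    have hinj : ∀ x, (S + P) x = 0 → x = 0 := by
      intro x hx
      have hx' : S x + P x = 0 := hx
      have hPx : P (P x) = P x := hPN _ ((Submodule.projectionL_eq_self_iff htop _).1 (by
        exact congrArg (fun A : X →L[ℂ] X => A x)
          (Submodule.isIdempotentElem_projectionL htop).eq))
      have h1 : S (P x) = -P x := by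
        have := congrArg P hx'
        rw [map_add, hSPcomm, hPx, map_zero] at this
        exact eq_neg_of_add_eq_zero_left this
      have h2 : ∀ k : ℕ, (S ^ k) (P x) = (-1 : ℂ) ^ k • P x := by
        intro k
        induction k with
        | zero => simp
        | succ k ih =>
          rw [pow_succ']
          change S ((S ^ k) (P x)) = _
          rw [ih, map_smul, h1, pow_succ, mul_smul, neg_one_smul]
      have h3 : P x = 0 := by
        have h4 : (S ^ p) (P x) = 0 := (Submodule.projectionL_eq_self_iff htop _).1 hPx
        rw [h2] at h4
        exact (smul_eq_zero.1 h4).resolve_left (by simp)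
      have h5 : S x = 0 := by rwa [h3, add_zero] at hx'
      have h6 : (S ^ p) x = 0 := by
        rw [hp, pow_succ]
        change (S ^ max n m) (S x) = 0
        rw [h5, map_zero]
      rw [← hPN x h6, h3]
    rw [ContinuousLinearMap.isUnit_iff_bijective]
    refine ⟨(injective_iff_map_eq_zero _).2 hinj, ?_⟩
    intro w
    obtain ⟨y, hy, z, hz, rfl⟩ := hdec w
    -- Surjectivity is checked on each summand: on the finite-dimensional kernel it follows from
    -- injectivity, and on `range (S ^ p)`, where `P` vanishes, from stability of the range.
    have hmaps : ∀ x ∈ (S ^ p).ker, (S + P) x ∈ (S ^ p).ker := by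
      intro x hx
      refine Submodule.add_mem _ ?_ ?_
      · rw [← hker1] at hx
        have : (S ^ (p + 1)) x = 0 := hx
        rwa [pow_succ] at this
      · change P x ∈ _
        rwa [hPN x hx]
    let e : (S ^ p).ker →ₗ[ℂ] (S ^ p).ker := (S + P).toLinearMap.restrict hmaps
    have he : Function.Surjective e := by
      refine LinearMap.injective_iff_surjective.1 ((injective_iff_map_eq_zero e).2 ?_)
      intro x hx
      exact Subtype.ext (hinj x (congrArg Subtype.val hx))
    obtain ⟨a, ha⟩ := he ⟨z, hz⟩
    rw [← hran1] at hy
    obtain ⟨b, hb⟩ := hy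
    refine ⟨(S ^ p) b + a, ?_⟩
    have h1 : (S + P) (a : X) = z := congrArg Subtype.val ha
    have h2 : S ((S ^ p) b) = y := by
      rw [← hb]
      exact (congrArg (fun A : X →L[ℂ] X => A b) (pow_succ' S p)).symm
    have h3 : P ((S ^ p) b) = 0 := hPM _ ⟨b, rfl⟩
    rw [map_add, h1, add_apply, h2, h3, add_zero]

theorem IsBrowder.isUnitAddFiniteRank [CompleteSpace X] {S : X →L[ℂ] X}
    (hS : IsBrowder S) : IsUnitAddFiniteRank S := by
  obtain ⟨P, hP, -, hu⟩ := hS.exists_finiteRank_isUnit_add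
  have := (IsUnitAddFiniteRank.of_isUnit hu).add_finiteRank (neg_mem hP)
  rwa [add_neg_cancel_right] at this

/-- An index zero Fredholm operator of finite ascent has finite descent. -/
theorem IsUnitAddFiniteRank.isBrowder {S : X →L[ℂ] X} (hS : IsUnitAddFiniteRank S)
    (h : ∃ n : ℕ, (S ^ n).ker = (S ^ (n + 1)).ker) : IsBrowder S := by
  refine ⟨h, ?_, hS.isFredholm.finite_ker⟩
  obtain ⟨n, hn⟩ := h
  refine ⟨n, ?_⟩
  -- Powers also have index zero, so equal kernels force equal finite codimensions of the nested
  -- ranges.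
  have h1 := (hS.pow n).finrank_ker_eq
  have h2 := (hS.pow (n + 1)).finrank_ker_eq
  rw [hn, h2] at h1
  have : FiniteDimensional ℂ (X ⧸ (S ^ (n + 1)).range) := (hS.pow (n + 1)).isFredholm.finite_coker
  have hle : (S ^ (n + 1)).range ≤ (S ^ n).range := by
    rintro _ ⟨x, rfl⟩
    refine ⟨S x, ?_⟩
    rw [pow_succ]
    rfl
  have hinj : Function.Injective (Submodule.factor hle) := by
    have : FiniteDimensional ℂ (X ⧸ (S ^ n).range) := (hS.pow n).isFredholm.finite_coker
    exact (LinearMap.injective_iff_surjective_of_finrank_eq_finrank h1).2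
      (Submodule.factor_surjective hle)
  refine le_antisymm (fun x hx => ?_) hle
  rw [← Submodule.Quotient.mk_eq_zero] at hx ⊢
  exact hinj (by rw [map_zero]; exact hx)

end SpectralNotions

/-! ### Riesz–Schauder theory near the finite rank operators -/

namespace SpectralNotions

variable {X : Type*} [NormedAddCommGroup X] [NormedSpace ℂ X]

/-- An operator close to a finite rank operator cannot map a bounded sequence to a uniformly
separated one. -/
theorem exists_norm_map_sub_lt {K F : X →L[ℂ] X} (hF : F ∈ finiteRankIdeal X)
    (hK : ‖K - F‖ < 1 / 8) {x : ℕ → X} (hx : ∀ n, ‖x n‖ = 1) :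
    ∃ i j, i < j ∧ ‖K (x j) - K (x i)‖ < 1 / 2 := by
  have : FiniteDimensional ℂ F.range := .of_fg hF
  have : ProperSpace F.range := FiniteDimensional.proper ℂ _
  let y : ℕ → F.range := fun n => ⟨F (x n), x n, rfl⟩
  have hy : ∀ n, y n ∈ Metric.closedBall (0 : F.range) ‖F‖ := fun n => by
    rw [mem_closedBall_zero_iff]
    simpa [hx] using F.le_opNorm (x n)
  obtain ⟨a, -, φ, hφ, hlim⟩ := (isCompact_closedBall (0 : F.range) ‖F‖).tendsto_subseq hy
  -- Error budget: `1 / 8` from `F`, plus at most `1 / 8 * 2` from `K - F` on a difference of unit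
  -- vectors, stays below the Riesz separation `1 / 2`.
  obtain ⟨N, hN⟩ := Metric.cauchySeq_iff.1 hlim.cauchySeq (1 / 8) (by norm_num)
  refine ⟨φ N, φ (N + 1), hφ N.lt_succ_self, ?_⟩
  have h1 : ‖F (x (φ (N + 1))) - F (x (φ N))‖ < 1 / 8 := by
    have := hN (N + 1) N.le_succ N le_rfl
    rwa [dist_eq_norm] at this
  set u := x (φ (N + 1)) with hu
  set v := x (φ N) with hv
  have h2 : ‖(K - F) (u - v)‖ ≤ 1 / 8 * 2 := by
    refine ((K - F).le_opNorm _).trans (mul_le_mul hK.le ?_ (norm_nonneg _) (by norm_num))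
    have := norm_sub_le u v
    rw [hu, hv, hx, hx] at this
    rw [hu, hv]
    linarith
  have h3 : K u - K v = (K - F) (u - v) + (F u - F v) := by
    simp only [map_sub, sub_apply]
    abel
  rw [h3]
  have := norm_add_le ((K - F) (u - v)) (F u - F v)
  linarith

/-- The Riesz lemma inside a subspace. -/
theorem exists_mem_norm_eq_one_of_lt {M N : Submodule ℂ X} (hM : IsClosed (M : Set X))
    (h : M < N) : ∃ x ∈ N, ‖x‖ = 1 ∧ ∀ y ∈ M, 1 / 2 ≤ ‖x - y‖ := by
  obtain ⟨z, hzN, hzM⟩ := SetLike.exists_of_lt h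
  have hcl : IsClosed ((M.comap N.subtype : Submodule ℂ N) : Set N) :=
    hM.preimage continuous_subtype_val
  obtain ⟨x, -, hx1, hx⟩ := riesz_lemma_of_lt_one hcl ⟨⟨z, hzN⟩, hzM⟩
    (r := 1 / 2) (by norm_num)
  exact ⟨x, x.2, hx1, fun y hy => hx ⟨y, h.le hy⟩ hy⟩

theorem isFredholm_mul {S T : X →L[ℂ] X} (hS : S.IsFredholm) (hT : T.IsFredholm) :
    (S * T).IsFredholm := by
  obtain ⟨B, hB1, hB2⟩ := isFredholm_iff_exists_inverse_mod_finiteRank.1 hS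
  obtain ⟨C, hC1, hC2⟩ := isFredholm_iff_exists_inverse_mod_finiteRank.1 hT
  refine isFredholm_iff_exists_inverse_mod_finiteRank.2 ⟨C * B, ?_, ?_⟩
  · have : C * B * (S * T) - 1 = C * (B * S - 1) * T + (C * T - 1) := by noncomm_ring
    rw [this]
    exact add_mem (Ideal.mul_mem_right _ _ (Ideal.mul_mem_left _ _ hB1)) hC1
  · have : S * T * (C * B) - 1 = S * (T * C - 1) * B + (S * B - 1) := by noncomm_ring
    rw [this]
    exact add_mem (Ideal.mul_mem_right _ _ (Ideal.mul_mem_left _ _ hC2)) hB2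

theorem isFredholm_pow {S : X →L[ℂ] X} (hS : S.IsFredholm) (n : ℕ) : (S ^ n).IsFredholm := by
  induction n with
  | zero => exact (IsUnitAddFiniteRank.of_isUnit (by simp)).isFredholm
  | succ n ih => rw [pow_succ]; exact isFredholm_mul ih hS

/-- If some power of `L` is close to the finite rank operators, then `1 - L` is Browder. -/
theorem isBrowder_one_sub [CompleteSpace X] {L F : X →L[ℂ] X} {m : ℕ}
    (hF : F ∈ finiteRankIdeal X) (h : ‖L ^ m - F‖ < 1 / 8) : IsBrowder (1 - L) := by
  set S := 1 - L with hS
  -- The geometric sum gives `S * Q = 1 - L ^ m`, an invertible operator plus a finite rank one, and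
  -- transfers the information on `L ^ m` to `S`.
  set Q := ∑ i ∈ Finset.range m, L ^ i with hQ
  have hSL : Commute S L := (Commute.one_left L).sub_left (Commute.refl L)
  have hSK : Commute S (L ^ m) := hSL.pow_right m
  have hSQ : Commute S Q := Commute.sum_right _ _ _ fun i _ => hSL.pow_right i
  have hmul : S * Q = 1 - L ^ m := mul_neg_geom_sum L m
  have hfred : S.IsFredholm := by
    refine isFredholm_of_commute_mul hSQ ?_
    have hu : IsUnit (1 - (L ^ m - F)) := isUnit_one_sub_of_norm_lt_one (h.trans (by norm_num))
    have := ((IsUnitAddFiniteRank.of_isUnit hu).add_finiteRank (neg_mem hF)).isFredholm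
    rw [hmul]
    convert this using 1
    abel
  have hKx : ∀ x, (L ^ m) x = x - S (Q x) := fun x => by
    have : (S * Q) x = (1 - L ^ m) x := by rw [hmul]
    change S (Q x) = x - (L ^ m) x at this
    rw [this]
    abel
  have happ : ∀ {A : X →L[ℂ] X}, Commute S A → ∀ (n : ℕ) x, (S ^ n) (A x) = A ((S ^ n) x) :=
    fun hA n x => congrArg (fun B : X →L[ℂ] X => B x) (hA.pow_left n).eq
  have hsucc : ∀ (n : ℕ) x, (S ^ (n + 1)) x = (S ^ n) (S x) := fun n x => by
    rw [pow_succ]; rfl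
  refine ⟨?_, ?_, hfred.finite_ker⟩
  -- If the kernels grew forever, take unit vectors `x n` in `ker (S ^ (n + 1))` at distance at
  -- least `1 / 2` from `ker (S ^ n)`. For `i < j`, `L ^ m` maps `x j - x i` to `x j` minus an
  -- element of `ker (S ^ j)`, so the images stay separated.
  · by_contra! hne
    have hmono : Monotone fun n => (S ^ n).ker := monotone_nat_of_le_succ fun n x hx => by
      have hx0 : (S ^ n) x = 0 := hx
      change (S ^ (n + 1)) x = 0
      rw [hsucc, happ (Commute.refl S), hx0, map_zero]
    choose x hxm hx1 hx using fun n =>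
      exists_mem_norm_eq_one_of_lt (S ^ n).isClosed_ker ((hmono n.le_succ).lt_of_ne (hne n))
    obtain ⟨i, j, hij, hlt⟩ := exists_norm_map_sub_lt hF h hx1
    have hmem : S (Q (x j)) + (L ^ m) (x i) ∈ (S ^ j).ker := by
      refine Submodule.add_mem _ ?_ (hmono (Nat.succ_le_of_lt hij) ?_)
      · change (S ^ j) (S (Q (x j))) = 0
        have : (S ^ (j + 1)) (x j) = 0 := hxm j
        rw [← hsucc, happ hSQ, this, map_zero]
      · change (S ^ (i + 1)) ((L ^ m) (x i)) = 0
        have : (S ^ (i + 1)) (x i) = 0 := hxm i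
        rw [happ hSK, this, map_zero]
    have := hx j _ hmem
    rw [hKx (x j), sub_sub] at hlt
    linarith
  -- Dual argument on decreasing ranges, with the roles of `i` and `j` exchanged; the Fredholm
  -- property supplies the closedness that the Riesz lemma needs.
  · by_contra! hne
    have hanti : Antitone fun n => (S ^ n).range := antitone_nat_of_succ_le fun n => by
      rintro _ ⟨x, rfl⟩
      exact ⟨S x, (hsucc n x).symm⟩
    choose x hxm hx1 hx using fun n =>
      exists_mem_norm_eq_one_of_lt (isFredholm_pow hfred (n + 1)).isClosed_range
        ((hanti n.le_succ).lt_of_ne (hne n).symm)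
    obtain ⟨i, j, hij, hlt⟩ := exists_norm_map_sub_lt hF h hx1
    have hmem : S (Q (x i)) + (L ^ m) (x j) ∈ (S ^ (i + 1)).range := by
      refine Submodule.add_mem _ ?_ (hanti (Nat.succ_le_of_lt hij) ?_)
      · obtain ⟨z, hz⟩ := hxm i
        have hz' : (S ^ i) z = x i := hz
        refine ⟨Q z, ?_⟩
        change (S ^ (i + 1)) (Q z) = _
        rw [hsucc, happ (Commute.refl S), happ hSQ, hz']
      · obtain ⟨z, hz⟩ := hxm j
        have hz' : (S ^ j) z = x j := hz
        refine ⟨(L ^ m) z, ?_⟩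
        change (S ^ j) ((L ^ m) z) = _
        rw [happ hSK, hz']
    have := hx i _ hmem
    rw [norm_sub_rev, hKx (x i), sub_sub] at hlt
    linarith

end SpectralNotions

/-! ### Commuting Riesz perturbations -/

namespace SpectralNotions

variable {X : Type*} [NormedAddCommGroup X] [NormedSpace ℂ X]

/-- An inverse modulo finite rank is unaffected by finite rank changes. This serves the Browder
case, where `R` is replaced by `R - P`. -/
theorem IsRiesz.sub_finiteRank {R F : X →L[ℂ] X} (hR : IsRiesz R) (hF : F ∈ finiteRankIdeal X) :
    IsRiesz (R - F) := by
  intro z hz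
  obtain ⟨B, hB1, hB2⟩ := isFredholm_iff_exists_inverse_mod_finiteRank.1 (hR z hz)
  refine isFredholm_iff_exists_inverse_mod_finiteRank.2 ⟨B, ?_, ?_⟩
  · have : B * shift (R - F) z - 1 = (B * shift R z - 1) - B * F := by
      simp only [shift]; noncomm_ring
    rw [this]
    exact sub_mem hB1 (Ideal.mul_mem_left _ _ hF)
  · have : shift (R - F) z * B - 1 = (shift R z * B - 1) - F * B := by
      simp only [shift, sub_mul, smul_mul_assoc, one_mul]; abel
    rw [this]
    exact sub_mem hB2 (Ideal.mul_mem_right _ _ hF)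

variable [CompleteSpace X]

/-- Some power of `V * R` is close to finite rank, so the Riesz–Schauder argument applies.
Commutation is asked only modulo finite rank because the invertible part of a Weyl operator need not
commute with `R`. -/
theorem IsRiesz.isBrowder_one_sub_mul {R V : X →L[ℂ] X} (hR : IsRiesz R)
    (hV : V * R - R * V ∈ finiteRankIdeal X) : IsBrowder (1 - V * R) := by
  obtain ⟨n, -, F, hF, h⟩ := exists_norm_mul_pow_sub_lt (finiteRankIdeal X)
    (fun z hz => isFredholm_iff_exists_inverse_mod_finiteRank.1 (hR z hz)) hV
    (ε := 1 / 8) (by norm_num)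
  exact isBrowder_one_sub hF h

/-- Index zero Fredholm operators are stable under commuting Riesz perturbations. -/
theorem IsUnitAddFiniteRank.add_riesz {S R : X →L[ℂ] X} (hS : IsUnitAddFiniteRank S)
    (hR : IsRiesz R) (h : Commute S R) : IsUnitAddFiniteRank (S + R) := by
  obtain ⟨U, hU⟩ := hS
  -- As `S` commutes with `R`, the commutator of `U` with `R` comes only from the finite rank part
  -- `S - U`; conjugating by `U⁻¹` passes to the inverse.
  have hV : (-(↑U⁻¹ : X →L[ℂ] X)) * R - R * (-(↑U⁻¹ : X →L[ℂ] X)) ∈ finiteRankIdeal X := by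
    have h1 : (U : X →L[ℂ] X) * R - R * U ∈ finiteRankIdeal X := by
      have : (U : X →L[ℂ] X) * R - R * U = R * (S - U) - (S - U) * R := by
        rw [mul_sub, sub_mul, h.eq]; abel
      rw [this]
      exact sub_mem (Ideal.mul_mem_left _ _ hU) (Ideal.mul_mem_right _ _ hU)
    have h2 : (-(↑U⁻¹ : X →L[ℂ] X)) * R - R * (-(↑U⁻¹ : X →L[ℂ] X)) =
        (↑U⁻¹ : X →L[ℂ] X) * (U * R - R * U) * ↑U⁻¹ := by
      rw [mul_sub, sub_mul, U.inv_mul_cancel_left, mul_assoc, mul_assoc R, U.mul_inv, mul_one]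
      noncomm_ring
    rw [h2]
    exact Ideal.mul_mem_right _ _ (Ideal.mul_mem_left _ _ h1)
  have hW := ((IsUnitAddFiniteRank.of_isUnit U.isUnit).mul
    (hR.isBrowder_one_sub_mul hV).isUnitAddFiniteRank).add_finiteRank hU
  convert hW using 1
  rw [neg_mul, sub_neg_eq_add, mul_add, mul_one, U.mul_inv_cancel_left]
  abel

/-- Browder operators are stable under commuting Riesz perturbations. -/
theorem IsBrowder.add_riesz {S R : X →L[ℂ] X} (hS : IsBrowder S) (hR : IsRiesz R)
    (h : Commute S R) : IsBrowder (S + R) := by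
  -- Index zero is already stable, so only finite ascent remains. With `U = S + P`, everything in `S
  -- + R = U (1 + U⁻¹ (R - P))` commutes, so the powers of `S + R` have the kernels of the powers of
  -- the second factor.
  refine (hS.isUnitAddFiniteRank.add_riesz hR h).isBrowder ?_
  obtain ⟨P, hP, hcomm, U, hU⟩ := hS.exists_finiteRank_isUnit_add
  have hPS : Commute P S := hcomm S (Commute.refl S)
  have hPR : Commute P R := hcomm R h
  have hUR : Commute (U : X →L[ℂ] X) (R - P) := by
    rw [hU]
    exact ((h.add_left hPR).sub_right (hPS.symm.add_left (Commute.refl P)))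
  have hVR : Commute (-(↑U⁻¹ : X →L[ℂ] X)) (R - P) := hUR.units_inv_left.neg_left
  have hB := (hR.sub_finiteRank hP).isBrowder_one_sub_mul (V := -(↑U⁻¹ : X →L[ℂ] X))
    (by rw [hVR.eq, sub_self]; exact zero_mem _)
  set A := 1 - -(↑U⁻¹ : X →L[ℂ] X) * (R - P) with hA
  have hfac : S + R = U * A := by
    rw [hA, neg_mul, sub_neg_eq_add, mul_add, mul_one, U.mul_inv_cancel_left, hU]
    abel
  have hUA : Commute (U : X →L[ℂ] X) A :=
    (Commute.one_right _).sub_right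
      (((Commute.refl (U : X →L[ℂ] X)).units_inv_right.neg_right).mul_right hUR)
  have hker : ∀ n : ℕ, ((S + R) ^ n).ker = (A ^ n).ker := by
    intro n
    rw [hfac, hUA.mul_pow, ← Units.val_pow_eq_pow_val]
    exact LinearEquiv.ker_comp (ContinuousLinearEquiv.ofUnit (U ^ n)).toLinearEquiv
      (A ^ n).toLinearMap
  obtain ⟨n, hn⟩ := hB.exists_ker_eq
  exact ⟨n, by rw [hker, hker, hn]⟩

/-! ### Spectral sets in terms of Browder and Weyl shifts -/

omit [CompleteSpace X] in
theorem mem_spectrum_iff_not_isUnit_shift {T : X →L[ℂ] X} {z : ℂ} :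
    z ∈ spectrum ℂ T ↔ ¬ IsUnit (shift T z) := by
  rw [spectrum.mem_iff, ← IsUnit.neg_iff, neg_sub, Algebra.algebraMap_eq_smul_one]
  rfl

omit [CompleteSpace X] in
theorem ascent_lt_top_iff {S : X →L[ℂ] X} :
    ascent S < ⊤ ↔ ∃ n : ℕ, (S ^ n).ker = (S ^ (n + 1)).ker := by
  rw [ascent, sInf_lt_iff]
  constructor
  · rintro ⟨_, ⟨n, -, hn⟩, -⟩
    exact ⟨n, hn⟩
  · rintro ⟨n, hn⟩
    exact ⟨n, ⟨n, rfl, hn⟩, ENat.natCast_lt_top n⟩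

omit [CompleteSpace X] in
theorem descent_lt_top_iff {S : X →L[ℂ] X} :
    descent S < ⊤ ↔ ∃ n : ℕ, (S ^ n).range = (S ^ (n + 1)).range := by
  rw [descent, sInf_lt_iff]
  constructor
  · rintro ⟨_, ⟨n, -, hn⟩, -⟩
    exact ⟨n, hn⟩
  · rintro ⟨n, hn⟩
    exact ⟨n, ⟨n, rfl, hn⟩, ENat.natCast_lt_top n⟩

omit [CompleteSpace X] in
theorem mem_finiteRankPoles_iff {T : X →L[ℂ] X} {z : ℂ} :
    z ∈ finiteRankPoles T ↔ z ∈ spectrum ℂ T ∧ IsBrowder (shift T z) := by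
  constructor
  · rintro ⟨⟨hz, ha, hd⟩, hf⟩
    exact ⟨hz, ascent_lt_top_iff.1 ha, descent_lt_top_iff.1 hd, hf⟩
  · rintro ⟨hz, ha, hd, hf⟩
    exact ⟨⟨hz, ascent_lt_top_iff.2 ha, descent_lt_top_iff.2 hd⟩, hf⟩

omit [CompleteSpace X] in
theorem approxPointSpectrum_subset_spectrum (T : X →L[ℂ] X) :
    approxPointSpectrum T ⊆ spectrum ℂ T := by
  intro z hz
  rw [mem_spectrum_iff_not_isUnit_shift]
  rintro ⟨U, hU⟩
  refine hz ⟨(‖(↑U⁻¹ : X →L[ℂ] X)‖ + 1)⁻¹, by positivity, fun x => ?_⟩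
  rw [← hU, inv_mul_le_iff₀ (by positivity)]
  have h1 : (↑U⁻¹ : X →L[ℂ] X) ((U : X →L[ℂ] X) x) = x :=
    congrArg (fun A : X →L[ℂ] X => A x) U.inv_mul
  calc ‖x‖ = ‖(↑U⁻¹ : X →L[ℂ] X) ((U : X →L[ℂ] X) x)‖ := by rw [h1]
    _ ≤ ‖(↑U⁻¹ : X →L[ℂ] X)‖ * ‖(U : X →L[ℂ] X) x‖ := ContinuousLinearMap.le_opNorm _ _
    _ ≤ _ := by gcongr; linarith

theorem IsUnitAddFiniteRank.isUnit_of_injective {S : X →L[ℂ] X} (hS : IsUnitAddFiniteRank S)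
    (h : Function.Injective S) : IsUnit S := by
  rw [ContinuousLinearMap.isUnit_iff_bijective]
  refine ⟨h, ?_⟩
  have h1 := hS.finrank_ker_eq
  have : FiniteDimensional ℂ (X ⧸ S.range) := hS.isFredholm.finite_coker
  rw [LinearMap.ker_eq_bot.2 h, finrank_bot, eq_comm, Module.finrank_zero_iff,
    Submodule.Quotient.subsingleton_iff] at h1
  exact LinearMap.range_eq_top.1 h1

/-- At such a pole the shift has index zero, so being bounded below would make it invertible; its
powers are Fredholm and thus have closed range. -/
theorem finiteRankPoles_subset_leftPoles (T : X →L[ℂ] X) :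
    finiteRankPoles T ⊆ leftPoles T := by
  intro z hz
  obtain ⟨hsp, hB⟩ := mem_finiteRankPoles_iff.1 hz
  have hW := hB.isUnitAddFiniteRank
  refine ⟨fun ⟨c, hc, h⟩ => ?_, ?_⟩
  · refine mem_spectrum_iff_not_isUnit_shift.1 hsp (hW.isUnit_of_injective ?_)
    rw [injective_iff_map_eq_zero]
    intro x hx
    have := h x
    rw [hx, norm_zero] at this
    exact norm_le_zero_iff.1 (nonpos_of_mul_nonpos_right this hc)
  · obtain ⟨a, ha⟩ := ENat.ne_top_iff_exists.1 (ascent_lt_top_iff.2 hB.exists_ker_eq).ne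
    exact ⟨a, ha.symm, (hW.pow (a + 1)).isFredholm.isClosed_range⟩

theorem finiteRankPoles_subset_spectrum_diff_weylSpectrum (T : X →L[ℂ] X) :
    finiteRankPoles T ⊆ spectrum ℂ T \ weylSpectrum T := by
  intro z hz
  obtain ⟨hsp, hB⟩ := mem_finiteRankPoles_iff.1 hz
  exact ⟨hsp, fun h => h hB.isUnitAddFiniteRank.isWeyl⟩

/-- Under property `(Z_{Π_a})` the left poles are the poles of finite rank. -/
theorem PropertyZ.finiteRankPoles_eq_leftPoles {T : X →L[ℂ] X} (hT : PropertyZ T) :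
    finiteRankPoles T = leftPoles T := by
  refine (finiteRankPoles_subset_leftPoles T).antisymm fun z hz => ?_
  obtain ⟨a, ha, -⟩ := hz.2
  have hmem := hz
  rw [← hT] at hmem
  refine mem_finiteRankPoles_iff.2 ⟨hmem.1, ?_⟩
  refine (isWeyl_iff_isUnitAddFiniteRank.1 (not_not.1 hmem.2)).isBrowder
    (ascent_lt_top_iff.1 ?_)
  rw [ha]
  exact ENat.natCast_lt_top a

end SpectralNotions

/-! ### The equivalences -/

open SpectralNotions in
theorem theorem3 {X : Type*} [NormedAddCommGroup X] [NormedSpace ℂ X] [CompleteSpace X]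
    (hX : ¬ FiniteDimensional ℂ X) (R T : X →L[ℂ] X)
    (hR : SpectralNotions.IsRiesz R) (hcomm : Commute T R)
    (hT : SpectralNotions.PropertyZ T) :
    List.TFAE [
      SpectralNotions.PropertyZ (T + R),
      SpectralNotions.finiteRankPoles (T + R) = SpectralNotions.leftPoles (T + R),
      SpectralNotions.leftPoles (T + R) ∩ spectrum ℂ T ⊆ SpectralNotions.finiteRankPoles T] := by
  have hshift : ∀ z, shift (T + R) z = shift T z + R := fun z => by
    simp only [shift]; abel
  have hc : ∀ z, Commute (shift T z) R := fun z =>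
    hcomm.sub_left ((Commute.one_left R).smul_left z)
  have hRneg : IsRiesz (-R) := fun z hz => by
    obtain ⟨B, hB1, hB2⟩ := isFredholm_iff_exists_inverse_mod_finiteRank.1
      (hR (-z) (neg_ne_zero.2 hz))
    have h : shift (-R) z = -shift R (-z) := by
      simp only [shift, neg_smul]; abel
    refine isFredholm_iff_exists_inverse_mod_finiteRank.2 ⟨-B, ?_, ?_⟩
    · rwa [h, neg_mul_neg]
    · rwa [h, neg_mul_neg]
  have hshift' : ∀ z, shift T z = shift (T + R) z + -R := fun z => by
    rw [hshift, add_neg_cancel_right]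
  have hc' : ∀ z, Commute (shift (T + R) z) (-R) := fun z => by
    rw [hshift]
    exact ((hc z).add_left (Commute.refl R)).neg_right
  have hBrowder : ∀ z, IsBrowder (shift T z) ↔ IsBrowder (shift (T + R) z) := fun z =>
    ⟨fun h => hshift z ▸ h.add_riesz hR (hc z),
      fun h => by rw [hshift' z]; exact h.add_riesz hRneg (hc' z)⟩
  have hWeyl : ∀ z, IsWeyl (shift (T + R) z) → IsWeyl (shift T z) := fun z h => by
    rw [isWeyl_iff_isUnitAddFiniteRank] at h ⊢
    rw [hshift' z]
    exact h.add_riesz hRneg (hc' z)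
  tfae_have 1 → 2 := fun h => h.finiteRankPoles_eq_leftPoles
  tfae_have 2 → 1 := by
    intro h
    rw [PropertyZ, ← h]
    refine Set.Subset.antisymm (fun z hz => ?_)
      (finiteRankPoles_subset_spectrum_diff_weylSpectrum _)
    refine mem_finiteRankPoles_iff.2 ⟨hz.1, (hBrowder z).1 ?_⟩
    -- The Weyl property descends from `T + R` to `T`; off the spectrum of `T` the shift is
    -- trivially Browder, and on it property `(Z_{Π_a})` of `T` makes `z` a finite rank pole.
    by_cases hu : IsUnit (shift T z)
    · exact isBrowder_of_isUnit hu
    · have hz' : z ∈ spectrum ℂ T \ weylSpectrum T :=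
        ⟨mem_spectrum_iff_not_isUnit_shift.2 hu, not_not.2 (hWeyl z (not_not.1 hz.2))⟩
      rw [hT, ← hT.finiteRankPoles_eq_leftPoles] at hz'
      exact (mem_finiteRankPoles_iff.1 hz').2
  tfae_have 2 → 3 := by
    rintro h z ⟨hz, hsp⟩
    rw [← h] at hz
    exact mem_finiteRankPoles_iff.2 ⟨hsp, (hBrowder z).2 (mem_finiteRankPoles_iff.1 hz).2⟩
  tfae_have 3 → 2 := by
    intro h
    refine (finiteRankPoles_subset_leftPoles _).antisymm fun z hz => ?_
    refine mem_finiteRankPoles_iff.2 ⟨approxPointSpectrum_subset_spectrum _ hz.1,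
      (hBrowder z).1 ?_⟩
    -- The hypothesis only concerns points of the spectrum of `T`, which is enough because an
    -- invertible shift is Browder.
    by_cases hu : IsUnit (shift T z)
    · exact isBrowder_of_isUnit hu
    · exact (mem_finiteRankPoles_iff.1 (h ⟨hz, mem_spectrum_iff_not_isUnit_shift.2 hu⟩)).2
  tfae_finish
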